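/- Let $\mathbb K$ be $\mathbb R$ or $\mathbb C$ and $n\in\mathbb N$. \emph{Conventions.} For maps $f,h$ with components $f_1,\dots,f_p$ and $h_1,\dots,h_m$, we say that $h$ is \emph{algebraic over $\mathbb K(f)$} on a set $W$ if for each $i$ there is $P_i\in\mathbb K[X_1,\dots,X_p,Y]$ of positive degree in $Y$ with $P_i(f(u),h_i(u))=0$ for all $u\in W$; for meromorphic maps $f,h$ on $\mathbb C^n$, $W$ is the set where both are defined (holomorphic). A \emph{$\mathbb K$-Nash map} is a $\mathbb K$-analytic map on an open semialgebraic subset of some $\mathbb K^p$ that is algebraic over $\mathbb K(\mathrm{id})$ there (semialgebraic in $\mathbb C^p=\mathbb R^{2p}$ if $\mathbb K=\mathbb C$). A \emph{locally $\mathbb K$-Nash group} is a topological group with an atlas of charts into $\mathbb K^p$ that have semialgebraic images and $\mathbb K$-Nash changes of charts, such that the group operations are locally $\mathbb K$-Nash maps, i.e. continuous and given near every point, in charts, by $\mathbb K$-Nash maps. An \emph{isomorphism} of locally $\mathbb K$-Nash groups is a group isomorphism which is a locally $\mathbb K$-Nash map together with its inverse. A meromorphic map $f:\mathbb C^n\dashrightarrow\mathbb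 C^n$ is called $\mathbb K$-meromorphic if $\mathbb K=\mathbb C$, or if $\mathbb K=\mathbb R$ and $\overline{f(\overline u)}=f(u)$ wherever $f$ is defined. Let $f,g:\mathbb C^n\dashrightarrow\mathbb C^n$ be $\mathbb K$-meromorphic maps, each of which (i) admits an algebraic addition theorem: $f_1,\dots,f_n$ are algebraically independent over $\mathbb K$ and, near $(0,0)$, $f(u+v)$ is algebraic over $\mathbb K(f(u),f(v))$ as a meromorphic map of $(u,v)$ (and likewise for $g$); and (ii) has a shift that is a chart at $0$: for some $a\in\mathbb K^n$ the map $u\mapsto f(u+a)$ is an analytic diffeomorphism from an open neighbourhood of $0$ in $\mathbb K^n$ onto an open subset of $\mathbb K^n$ (and likewise for $g$). Denote by $(\mathbb K^n,+,f)$ the additive group $\mathbb K^n$ with an atlas consisting of all translates $(c+V,\ u\mapsto\varphi(u-c))$, $c\in\mathbb K^n$, where $\varphi(u)=f(u+a)$ for a point $a$ as in (ii) and $V$ is an open neighbourhood of $0$ on which $\varphi$ is an analytic diffeomorphism onto its image and for which this is a locally $\mathbb K$-Nash group; similarly for $(\mathbb K^n,+,g)$. Then, for all such choices of the points and neighbourhoods,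 the locally $\mathbb K$-Nash groups $(\mathbb K^n,+,f)$ and $(\mathbb K^n,+,g)$ are isomorphic if and only if there exists $\alpha\in\mathrm{GL}_n(\mathbb K)$ such that $g\circ\alpha$ is algebraic over $\mathbb K(f)$. -/

import Mathlib

open Set Filter Topology

noncomputable section

/-! ### Algebraic dependence of functions -/

/-- Let `K → L` be a homomorphism of fields.  The map `f : X → L ^ κ` is algebraic over
`K(g) = K(g₁, …, gₙ)`, `g : X → L ^ ι`, on the set `W`: for each component `fᵢ` there is a
polynomial `P ∈ K[X₁, …, Xₙ][Y]`, of positive degree in `Y`, with `P(g(u), fᵢ(u)) = 0` for all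
`u ∈ W`. -/
def AlgebraicOver {K L X ι κ : Type*} [Field K] [Field L] (j : K →+* L)
    (f : X → κ → L) (g : X → ι → L) (W : Set X) : Prop :=
  ∀ i : κ, ∃ P : Polynomial (MvPolynomial ι K), 0 < P.natDegree ∧
    ∀ u ∈ W, P.eval₂ (MvPolynomial.eval₂Hom j (g u)) (f u i) = 0

/-! ### Semialgebraic sets and Nash maps -/

/-- Semialgebraic subsets of `ℝ ^ ι`: the Boolean algebra of sets generated by the sets
`{x | 0 < p x}`, `p` a real polynomial. -/
inductive IsSemialgebraicReal {ι : Type*} : Set (ι → ℝ) → Prop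
  | pos (p : MvPolynomial ι ℝ) : IsSemialgebraicReal {x | 0 < MvPolynomial.eval x p}
  | compl {S : Set (ι → ℝ)} : IsSemialgebraicReal S → IsSemialgebraicReal Sᶜ
  | union {S T : Set (ι → ℝ)} :
      IsSemialgebraicReal S → IsSemialgebraicReal T → IsSemialgebraicReal (S ∪ T)

/-- The real and imaginary parts of the coordinates of a point of `𝕂 ^ ι`. -/
def realCoords {𝕂 : Type*} [RCLike 𝕂] {ι : Type*} (x : ι → 𝕂) : ι ⊕ ι → ℝ :=
  Sum.elim (fun i => RCLike.re (x i)) (fun i => RCLike.im (x i))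

/-- Semialgebraic subsets of `𝕂 ^ ι`.  For `𝕂 = ℂ`, where `realCoords` is a bijection onto
`ℝ ^ (2n)`, these are the sets that are semialgebraic as subsets of `ℝ ^ (2n)`; for `𝕂 = ℝ`, where
`realCoords x = (x, 0)`, they are the usual semialgebraic subsets of `ℝ ^ n`. -/
def IsSemialgebraic {𝕂 : Type*} [RCLike 𝕂] {ι : Type*} (S : Set (ι → 𝕂)) : Prop :=
  ∃ T : Set (ι ⊕ ι → ℝ), IsSemialgebraicReal T ∧ S = realCoords ⁻¹' T

/-- `f` is a `𝕂`-Nash map on `U`: `U` is open and semialgebraic, and `f` is `𝕂`-analytic and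
algebraic over `𝕂(id)` on `U`. -/
structure IsNashOn {𝕂 : Type*} [RCLike 𝕂] {ι κ : Type*} [Fintype ι] [Fintype κ]
    (f : (ι → 𝕂) → (κ → 𝕂)) (U : Set (ι → 𝕂)) : Prop where
  isOpen : IsOpen U
  semialgebraic : IsSemialgebraic U
  analytic : AnalyticOnNhd 𝕂 f U
  algebraic : AlgebraicOver (RingHom.id 𝕂) f id U

/-! ### Locally Nash manifolds and locally Nash groups -/

/-- A `𝕂`-Nash atlas on `M`: a family of charts that covers `M`, with semialgebraic images and
with `𝕂`-Nash changes of charts (in both directions, as `e` and `e'` may be exchanged). -/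
structure IsNashAtlas {𝕂 : Type*} [RCLike 𝕂] {ι M : Type*} [Fintype ι] [TopologicalSpace M]
    (A : Set (OpenPartialHomeomorph M (ι → 𝕂))) : Prop where
  cover : ∀ x : M, ∃ e ∈ A, x ∈ e.source
  semialgebraic : ∀ e ∈ A, IsSemialgebraic e.target
  compatible : ∀ e ∈ A, ∀ e' ∈ A, IsNashOn (e' ∘ e.symm) (e '' (e.source ∩ e'.source))

/-- Locally `𝕂`-Nash maps between manifolds with given atlases. -/
structure IsLocallyNashMap {𝕂 : Type*} [RCLike 𝕂] {ι κ M N : Type*} [Fintype ι] [Fintype κ]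
    [TopologicalSpace M] [TopologicalSpace N]
    (A : Set (OpenPartialHomeomorph M (ι → 𝕂))) (B : Set (OpenPartialHomeomorph N (κ → 𝕂)))
    (f : M → N) : Prop where
  continuous : Continuous f
  nash : ∀ a : M, ∀ ψ ∈ B, f a ∈ ψ.source →
    ∃ φ ∈ A, ∃ U : Set M, IsOpen U ∧ a ∈ U ∧ U ⊆ φ.source ∧ MapsTo f U ψ.source ∧
      IsNashOn (ψ ∘ f ∘ φ.symm) (φ '' U)

/-- The product of two charts, with values in `𝕂 ^ (ι ⊕ κ) = 𝕂 ^ ι × 𝕂 ^ κ`. -/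
def prodChart {𝕂 : Type*} [RCLike 𝕂] {ι κ M N : Type*}
    [TopologicalSpace M] [TopologicalSpace N]
    (e : OpenPartialHomeomorph M (ι → 𝕂)) (e' : OpenPartialHomeomorph N (κ → 𝕂)) :
    OpenPartialHomeomorph (M × N) (ι ⊕ κ → 𝕂) :=
  (e.prod e').transHomeomorph Homeomorph.sumArrowHomeomorphProdArrow.symm

/-- The product atlas on `M × N`. -/
def prodAtlas {𝕂 : Type*} [RCLike 𝕂] {ι κ M N : Type*}
    [TopologicalSpace M] [TopologicalSpace N]
    (A : Set (OpenPartialHomeomorph M (ι → 𝕂))) (B : Set (OpenPartialHomeomorph N (κ → 𝕂))) :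
    Set (OpenPartialHomeomorph (M × N) (ι ⊕ κ → 𝕂)) :=
  Set.image2 prodChart A B

/-- A locally `𝕂`-Nash group structure on the topological group `G`, written additively: a
`𝕂`-Nash atlas for which the group operations are locally `𝕂`-Nash maps. -/
structure LocallyNashGroup (𝕂 : Type*) [RCLike 𝕂] (ι G : Type*) [Fintype ι]
    [TopologicalSpace G] [AddGroup G] where
  atlas : Set (OpenPartialHomeomorph G (ι → 𝕂))
  isNashAtlas : IsNashAtlas atlas
  add_nash : IsLocallyNashMap (prodAtlas atlas atlas) atlas (fun p : G × G => p.1 + p.2)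
  neg_nash : IsLocallyNashMap atlas atlas (fun x : G => -x)

/-- Isomorphisms of locally `𝕂`-Nash groups: isomorphisms of groups that are locally `𝕂`-Nash in
both directions. -/
def LocallyNashGroup.Isomorphic {𝕂 : Type*} [RCLike 𝕂] {ι κ G H : Type*} [Fintype ι] [Fintype κ]
    [TopologicalSpace G] [AddGroup G] [TopologicalSpace H] [AddGroup H]
    (𝒢 : LocallyNashGroup 𝕂 ι G) (ℋ : LocallyNashGroup 𝕂 κ H) : Prop :=
  ∃ α : G ≃+ H, IsLocallyNashMap 𝒢.atlas ℋ.atlas α ∧ IsLocallyNashMap ℋ.atlas 𝒢.atlas α.symm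

/-- The family of charts `(c + V, u ↦ φ (-c + u))`, `c ∈ G`, obtained from one chart `(V, φ)` by
translation. -/
def translatedAtlas {𝕂 : Type*} [RCLike 𝕂] {ι G : Type*}
    [TopologicalSpace G] [AddGroup G] [ContinuousAdd G]
    (φ : OpenPartialHomeomorph G (ι → 𝕂)) : Set (OpenPartialHomeomorph G (ι → 𝕂)) :=
  Set.range fun c : G => (Homeomorph.addLeft (-c)).transOpenPartialHomeomorph φ

/-! ### Meromorphic maps -/

/-- The set of points at which a map between complex spaces is defined (holomorphic). -/
def holoDomain {n : ℕ} {κ : Type*} [Fintype κ] (f : (Fin n → ℂ) → (κ → ℂ)) :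
    Set (Fin n → ℂ) :=
  {u | AnalyticAt ℂ f u}

/-- `f : ℂ ^ n ⇢ ℂ ^ κ` is meromorphic: near every point each component is a quotient of two
holomorphic functions, the denominator not vanishing identically near that point.  A meromorphic
map is represented by a total function, whose values where the denominators vanish are
irrelevant. -/
def IsMeromorphicMap {n : ℕ} {κ : Type*} (f : (Fin n → ℂ) → (κ → ℂ)) : Prop :=
  ∀ (p : Fin n → ℂ) (i : κ), ∃ g h : (Fin n → ℂ) → ℂ,
    AnalyticAt ℂ g p ∧ AnalyticAt ℂ h p ∧ (¬ ∀ᶠ u in 𝓝 p, h u = 0) ∧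
      ∀ᶠ u in 𝓝 p, h u ≠ 0 → f u i = g u / h u

/-- `f` commutes with complex conjugation, where it is defined. -/
def IsInvariantMap {n : ℕ} {κ : Type*} [Fintype κ] (f : (Fin n → ℂ) → (κ → ℂ)) : Prop :=
  ∀ u ∈ holoDomain f, star u ∈ holoDomain f → star (f (star u)) = f u

/-- `𝕂`-meromorphic maps: meromorphic for `𝕂 = ℂ`, invariant meromorphic for `𝕂 = ℝ`.  (The case
`𝕂 = ℝ` is singled out by `RCLike.I = 0`.) -/
structure IsKMeromorphicMap (𝕂 : Type*) [RCLike 𝕂] {n : ℕ} {κ : Type*} [Fintype κ]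
    (f : (Fin n → ℂ) → (κ → ℂ)) : Prop where
  meromorphic : IsMeromorphicMap f
  invariant : (RCLike.I : 𝕂) = 0 → IsInvariantMap f

/-- The inclusion of `𝕂` (which is `ℝ` or `ℂ`) into `ℂ`. -/
def toComplex (𝕂 : Type*) [RCLike 𝕂] : 𝕂 →+* ℂ where
  toFun z := ⟨RCLike.re z, RCLike.im z⟩
  map_one' := by apply Complex.ext <;> simp
  map_zero' := by apply Complex.ext <;> simp
  map_add' x y := by apply Complex.ext <;> simp
  map_mul' x y := by apply Complex.ext <;> simp [RCLike.mul_re, RCLike.mul_im]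

/-- The inclusion of `𝕂 ^ n` into `ℂ ^ n`. -/
def toComplexVec {𝕂 : Type*} [RCLike 𝕂] {n : ℕ} (u : Fin n → 𝕂) : Fin n → ℂ :=
  fun i => toComplex 𝕂 (u i)

/-- The germ at `0` of the meromorphic map `f : ℂ ^ n ⇢ ℂ ^ n` admits an algebraic addition theorem
over `𝕂`: `f₁, …, fₙ` are algebraically independent over `𝕂`, and `f (u + v)` is algebraic over
`𝕂(f(u), f(v))`. -/
structure AdmitsAAT (𝕂 : Type*) [RCLike 𝕂] {n : ℕ} (f : (Fin n → ℂ) → (Fin n → ℂ)) : Prop where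
  independent : ∀ Q : MvPolynomial (Fin n) 𝕂,
    (∀ᶠ u in 𝓝 (0 : Fin n → ℂ), u ∈ holoDomain f → Q.eval₂ (toComplex 𝕂) (f u) = 0) → Q = 0
  addition : ∃ W ∈ 𝓝 (0 : (Fin n → ℂ) × (Fin n → ℂ)),
    AlgebraicOver (toComplex 𝕂) (fun p : (Fin n → ℂ) × (Fin n → ℂ) => f (p.1 + p.2))
      (fun p => Sum.elim (f p.1) (f p.2))
      (W ∩ {p | p.1 ∈ holoDomain f ∧ p.2 ∈ holoDomain f ∧ p.1 + p.2 ∈ holoDomain f})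

/-! ### The locally Nash groups `(𝕂 ^ n, +, f)` -/

/-- `φ` is, for some `a ∈ 𝕂 ^ n`, the map `u ↦ f (u + a)` on an open neighbourhood `φ.source` of `0`
in `𝕂 ^ n`, and it is an analytic diffeomorphism onto its image `φ.target`, an open subset of
`𝕂 ^ n`. -/
structure IsShiftChart {𝕂 : Type*} [RCLike 𝕂] {n : ℕ} (f : (Fin n → ℂ) → (Fin n → ℂ))
    (φ : OpenPartialHomeomorph (Fin n → 𝕂) (Fin n → 𝕂)) : Prop where
  zero_mem : 0 ∈ φ.source
  eq_shift : ∃ a : Fin n → 𝕂, ∀ u ∈ φ.source,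
    toComplexVec (u + a) ∈ holoDomain f ∧ toComplexVec (φ u) = f (toComplexVec (u + a))
  analytic : AnalyticOnNhd 𝕂 φ φ.source
  analytic_symm : AnalyticOnNhd 𝕂 φ.symm φ.target

/-- The standing assumptions on `f` under which one speaks of `(𝕂 ^ n, +, f)`: `f` is
`𝕂`-meromorphic, it admits an algebraic addition theorem, and some shift `u ↦ f (u + a)`,
`a ∈ 𝕂 ^ n`, is an analytic diffeomorphism from a neighbourhood of `0` in `𝕂 ^ n` onto its image
in `𝕂 ^ n`. -/
structure IsNashDatum (𝕂 : Type*) [RCLike 𝕂] {n : ℕ} (f : (Fin n → ℂ) → (Fin n → ℂ)) : Prop where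
  meromorphic : IsKMeromorphicMap 𝕂 f
  aat : AdmitsAAT 𝕂 f
  exists_chart : ∃ φ : OpenPartialHomeomorph (Fin n → 𝕂) (Fin n → 𝕂), IsShiftChart f φ

/-- The locally `𝕂`-Nash group `𝒢` is `(𝕂 ^ n, +, f)`: its atlas consists of the translates of a
chart `u ↦ f (u + a)`, restricted to an open neighbourhood `V` of `0`.  (The point `a` and the
neighbourhood `V` are not determined by `f`.) -/
def LocallyNashGroup.IsGivenBy {𝕂 : Type*} [RCLike 𝕂] {n : ℕ}
    (𝒢 : LocallyNashGroup 𝕂 (Fin n) (Fin n → 𝕂)) (f : (Fin n → ℂ) → (Fin n → ℂ)) : Prop :=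
  ∃ φ : OpenPartialHomeomorph (Fin n → 𝕂) (Fin n → 𝕂),
    IsShiftChart f φ ∧ 𝒢.atlas = translatedAtlas φ

/-- For meromorphic maps `f : ℂ ^ n ⇢ ℂ ^ ι` and `h : ℂ ^ n ⇢ ℂ ^ κ`: `h` is algebraic over
`𝕂(f)`, the polynomial relations being required wherever `f` and `h` are both defined. -/
def MeromorphicAlgebraicOver (𝕂 : Type*) [RCLike 𝕂] {n : ℕ} {ι κ : Type*} [Fintype ι] [Fintype κ]
    (h : (Fin n → ℂ) → (κ → ℂ)) (f : (Fin n → ℂ) → (ι → ℂ)) : Prop :=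
  AlgebraicOver (toComplex 𝕂) h f (holoDomain h ∩ holoDomain f)

/-- The action of `α ∈ GL_n(𝕂)` on `ℂ ^ n`. -/
def glAct {𝕂 : Type*} [RCLike 𝕂] {n : ℕ} (α : GL (Fin n) 𝕂) (u : Fin n → ℂ) : Fin n → ℂ :=
  ((α : Matrix (Fin n) (Fin n) 𝕂).map (toComplex 𝕂)).mulVec u

end

/-!
An additive isomorphism between the two groups is a linear automorphism `α` of `𝕂 ^ n`: it is
continuous, hence `ℝ`-linear, and it is `𝕂`-differentiable at `0` because it is `𝕂`-analytic in
charts (`IsLocallyNashMap.map_smul`).  In charts, `α` being Nash near a point says that a translate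
of `g ∘ α` is algebraic over a translate of `f`, on a non-empty open subset of `𝕂 ^ n`.  So two
things have to be shown: that such relations between meromorphic maps extend from an open subset
of `𝕂 ^ n` to all of `ℂ ^ n`, and that translates are immaterial.

The first is the identity theorem.  Functions on `ℂ ^ n` that are locally quotients of holomorphic
functions form a ring, and the ideal of those vanishing off a meagre set is prime
(`genericallyZero_isPrime`), because a meromorphic function that vanishes near one point vanishes
generically (`IsMeromorphicFun.eventually_residual_eq_zero`).  A function that is holomorphic near a
point of `𝕂 ^ n` and vanishes there along real directions vanishes near this point
(`eventually_eq_zero_of_real`).  Conversely, a generic relation holds by continuity wherever the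
maps are holomorphic.

For the second, compatibility of a chart with its translate by a small vector `t` says that
`g (u + t)` is algebraic over `𝕂(g)`.  Algebraic dependence is transitive in the domain of
meromorphic functions modulo generic equality, and every vector is a multiple of a small one, so
this holds for all `t ∈ 𝕂 ^ n` (`genericallyAlgebraicOver_shift`).

Finally, if `g ∘ α` is algebraic over `𝕂(f)` then `f` is algebraic over `𝕂(g ∘ α)`, as both
families consist of `n` algebraically independent functions
(`GenericallyAlgebraicOver.exchange`); hence both `α` and its inverse are locally Nash.
-/

noncomputable section

/-! ### Meromorphic functions of several variables -/

/-- `F` is meromorphic on the complex normed space `E`: locally it is a quotient of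
two holomorphic functions, the denominator not vanishing identically near the point; the values
where the denominator vanishes are arbitrary. -/
def IsMeromorphicFun {E : Type*} [NormedAddCommGroup E] [NormedSpace ℂ E] (F : E → ℂ) : Prop :=
  ∀ p : E, ∃ g h : E → ℂ, AnalyticAt ℂ g p ∧ AnalyticAt ℂ h p ∧ (¬ ∀ᶠ u in 𝓝 p, h u = 0) ∧
    ∀ᶠ u in 𝓝 p, h u ≠ 0 → F u = g u / h u

section Meromorphic

variable {E : Type*} [NormedAddCommGroup E] [NormedSpace ℂ E] {F G : E → ℂ}

/-- Two functions holomorphic at `p` are holomorphic on a common ball around `p`, on which a given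
property valid near `p` holds. -/
theorem exists_ball_analyticOnNhd {g h : E → ℂ} {p : E} (hg : AnalyticAt ℂ g p)
    (hh : AnalyticAt ℂ h p) {q : E → Prop} (hq : ∀ᶠ u in 𝓝 p, q u) :
    ∃ r > 0, AnalyticOnNhd ℂ g (Metric.ball p r) ∧ AnalyticOnNhd ℂ h (Metric.ball p r) ∧
      ∀ u ∈ Metric.ball p r, q u := by
  obtain ⟨r, hr, H⟩ := Metric.eventually_nhds_iff_ball.1
    (hg.eventually_analyticAt.and (hh.eventually_analyticAt.and hq))
  exact ⟨r, hr, fun u hu => (H u hu).1, fun u hu => (H u hu).2.1, fun u hu => (H u hu).2.2⟩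

theorem eqOn_ball_zero_of_eventuallyEq_zero {g : E → ℂ} {p q : E} {r : ℝ}
    (hg : AnalyticOnNhd ℂ g (Metric.ball p r)) (hq : q ∈ Metric.ball p r)
    (h0 : ∀ᶠ u in 𝓝 q, g u = 0) : EqOn g 0 (Metric.ball p r) :=
  hg.eqOn_zero_of_preconnected_of_eventuallyEq_zero (convex_ball p r).isPreconnected hq h0

/-- Normal form of a meromorphic function near a point: a quotient on a whole ball, the
denominator not vanishing identically near any point of the ball. -/
theorem IsMeromorphicFun.exists_ball (hF : IsMeromorphicFun F) (p : E) :
    ∃ (g h : E → ℂ) (r : ℝ), 0 < r ∧ AnalyticOnNhd ℂ g (Metric.ball p r) ∧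
      AnalyticOnNhd ℂ h (Metric.ball p r) ∧
      (∀ u ∈ Metric.ball p r, ∃ᶠ v in 𝓝 u, h v ≠ 0) ∧
      ∀ u ∈ Metric.ball p r, h u ≠ 0 → F u = g u / h u := by
  obtain ⟨g, h, hg, hh, h0, hq⟩ := hF p
  obtain ⟨r, hr, hg', hh', hq'⟩ := exists_ball_analyticOnNhd hg hh hq
  refine ⟨g, h, r, hr, hg', hh', fun u hu hev => h0 ?_, hq'⟩
  have := eqOn_ball_zero_of_eventuallyEq_zero hh' hu (hev.mono fun v hv => not_not.1 hv)
  exact eventually_of_mem (Metric.ball_mem_nhds p hr) this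

theorem analyticAt_of_eq_div {g h : E → ℂ} {p u : E} {r : ℝ}
    (hg : AnalyticOnNhd ℂ g (Metric.ball p r)) (hh : AnalyticOnNhd ℂ h (Metric.ball p r))
    (hF : ∀ u ∈ Metric.ball p r, h u ≠ 0 → F u = g u / h u)
    (hu : u ∈ Metric.ball p r) (h0 : h u ≠ 0) : AnalyticAt ℂ F u := by
  refine ((hg u hu).div (hh u hu) h0).congr ?_
  filter_upwards [Metric.isOpen_ball.mem_nhds hu, (hh u hu).continuousAt.eventually_ne h0]
    with v hv hv0 using (hF v hv hv0).symm

theorem IsMeromorphicFun.dense_analyticAt (hF : IsMeromorphicFun F) :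
    Dense {u | AnalyticAt ℂ F u} := by
  intro p
  obtain ⟨g, h, r, hr, hg, hh, h0, hq⟩ := hF.exists_ball p
  rw [mem_closure_iff_frequently]
  refine ((h0 p (Metric.mem_ball_self hr)).and_eventually (Metric.ball_mem_nhds p hr)).mono ?_
  exact fun u hu => analyticAt_of_eq_div hg hh hq hu.2 hu.1

theorem IsMeromorphicFun.analyticAt_mem_residual (hF : IsMeromorphicFun F) :
    {u | AnalyticAt ℂ F u} ∈ residual E :=
  residual_of_dense_open (isOpen_analyticAt ℂ F) hF.dense_analyticAt

/-- The identity theorem for meromorphic functions.  Vanishing of `F` at its points of holomorphy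
near a point is an open condition on the point, and a closed one by the identity theorem for
numerators and denominators. -/
theorem IsMeromorphicFun.eventually_residual_eq_zero (hF : IsMeromorphicFun F) {p₀ : E}
    (h₀ : ∀ᶠ u in 𝓝 p₀, F u = 0) : ∀ᶠ u in residual E, F u = 0 := by
  let Z : Set E := {p | ∀ᶠ u in 𝓝 p, AnalyticAt ℂ F u → F u = 0}
  have hopen : IsOpen Z := isOpen_iff_eventually.2 fun p hp => eventually_eventually_nhds.2 hp
  have hclosed : IsClosed Z := by
    refine isClosed_of_closure_subset fun p hp => ?_
    obtain ⟨g, h, r, hr, hg, hh, h0, hq⟩ := hF.exists_ball p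
    obtain ⟨q, hqb, hqZ⟩ := mem_closure_iff_nhds.1 hp _ (Metric.ball_mem_nhds p hr)
    -- near `q` the function `F` vanishes where `h` does not, so `g * h` vanishes identically
    have hg0 : EqOn (g * h) 0 (Metric.ball p r) := by
      refine eqOn_ball_zero_of_eventuallyEq_zero (hg.mul hh) hqb ?_
      filter_upwards [hqZ, Metric.isOpen_ball.mem_nhds hqb] with u hu hub
      by_cases hu0 : h u = 0
      · simp [hu0]
      · have := hu (analyticAt_of_eq_div hg hh hq hub hu0)
        rw [hq u hub hu0, div_eq_zero_iff] at this
        simp [this.resolve_right hu0]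
    refine eventually_of_mem (Metric.ball_mem_nhds p hr) fun u hu hFu => ?_
    by_contra hne
    obtain ⟨v, ⟨hv, hvb⟩, hvne⟩ := (((h0 u hu).and_eventually
      (Metric.isOpen_ball.mem_nhds hu)).and_eventually
      (hFu.continuousAt.eventually_ne hne)).exists
    have := hg0 hvb
    apply hvne
    rw [hq v hvb hv, (mul_eq_zero.1 this).resolve_right hv, zero_div]
  have hZ : Z = univ := IsClopen.eq_univ ⟨hclosed, hopen⟩ ⟨p₀, h₀.mono fun u hu _ => hu⟩
  filter_upwards [hF.analyticAt_mem_residual] with u hu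
  have : u ∈ Z := hZ ▸ mem_univ u
  exact this.self_of_nhds hu

theorem eq_zero_of_eventually_residual {X : Type*} [TopologicalSpace X] [BaireSpace X]
    {F : X → ℂ} (h : ∀ᶠ u in residual X, F u = 0) {p : X} (hp : ContinuousAt F p) : F p = 0 := by
  by_contra hne
  obtain ⟨v, hv, hv0⟩ := ((mem_closure_iff_frequently.1
    ((dense_of_mem_residual h) p)).and_eventually (hp.eventually_ne hne)).exists
  exact hv0 hv

theorem AnalyticAt.isMeromorphicFun (h : ∀ p, AnalyticAt ℂ F p) : IsMeromorphicFun F :=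
  fun p => ⟨F, 1, h p, analyticAt_const,
    by simpa using (NeBot.ne inferInstance : 𝓝 p ≠ ⊥), by simp⟩

theorem frequently_mul_ne_zero {g h : E → ℂ} {p : E} (hg : AnalyticAt ℂ g p)
    (hh : AnalyticAt ℂ h p) (hg0 : ¬ ∀ᶠ u in 𝓝 p, g u = 0) (hh0 : ¬ ∀ᶠ u in 𝓝 p, h u = 0) :
    ¬ ∀ᶠ u in 𝓝 p, g u * h u = 0 := by
  intro H
  obtain ⟨r, hr, hg', hh', H'⟩ := exists_ball_analyticOnNhd hg hh H
  obtain ⟨v, hv, hvb⟩ := ((not_eventually.1 hg0).and_eventually (Metric.ball_mem_nhds p hr)).exists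
  refine hh0 (eventually_of_mem (Metric.ball_mem_nhds p hr)
    (eqOn_ball_zero_of_eventuallyEq_zero hh' hvb ?_))
  filter_upwards [(hg' v hvb).continuousAt.eventually_ne hv, Metric.isOpen_ball.mem_nhds hvb]
    with u hu hub using (mul_eq_zero.1 (H' u hub)).resolve_left hu

theorem IsMeromorphicFun.add (hF : IsMeromorphicFun F) (hG : IsMeromorphicFun G) :
    IsMeromorphicFun (F + G) := by
  intro p
  obtain ⟨g, h, hg, hh, h0, hq⟩ := hF p
  obtain ⟨g', h', hg', hh', h0', hq'⟩ := hG p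
  refine ⟨g * h' + h * g', h * h', (hg.mul hh').add (hh.mul hg'), hh.mul hh',
    frequently_mul_ne_zero hh hh' h0 h0', ?_⟩
  filter_upwards [hq, hq'] with u hu hu' hne
  have h1 : h u ≠ 0 := left_ne_zero_of_mul hne
  have h2 : h' u ≠ 0 := right_ne_zero_of_mul hne
  simp only [Pi.add_apply, Pi.mul_apply, hu h1, hu' h2, div_add_div _ _ h1 h2]

theorem IsMeromorphicFun.mul (hF : IsMeromorphicFun F) (hG : IsMeromorphicFun G) :
    IsMeromorphicFun (F * G) := by
  intro p
  obtain ⟨g, h, hg, hh, h0, hq⟩ := hF p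
  obtain ⟨g', h', hg', hh', h0', hq'⟩ := hG p
  refine ⟨g * g', h * h', hg.mul hg', hh.mul hh', frequently_mul_ne_zero hh hh' h0 h0', ?_⟩
  filter_upwards [hq, hq'] with u hu hu' hne
  simp only [Pi.mul_apply, hu (left_ne_zero_of_mul hne), hu' (right_ne_zero_of_mul hne),
    div_mul_div_comm]

theorem IsMeromorphicFun.neg (hF : IsMeromorphicFun F) : IsMeromorphicFun (-F) := by
  intro p
  obtain ⟨g, h, hg, hh, h0, hq⟩ := hF p
  refine ⟨-g, h, hg.neg, hh, h0, ?_⟩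
  filter_upwards [hq] with u hu hne
  simp only [Pi.neg_apply, hu hne, neg_div]

theorem IsMeromorphicFun.comp_homeomorph (hF : IsMeromorphicFun F) (A : E ≃ₜ E)
    (hA : ∀ p, AnalyticAt ℂ A p) : IsMeromorphicFun (F ∘ A) := by
  intro p
  obtain ⟨g, h, hg, hh, h0, hq⟩ := hF (A p)
  refine ⟨g ∘ A, h ∘ A, hg.comp (hA p), hh.comp (hA p), fun H => h0 ?_, ?_⟩
  · rw [← A.map_nhds_eq p, eventually_map]
    exact H
  · rw [← A.map_nhds_eq p, eventually_map] at hq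
    exact hq

variable (E) in
/-- The ring of meromorphic functions on `E`, as functions with arbitrary values at the poles. -/
def meromorphicSubring : Subring (E → ℂ) where
  carrier := {F | IsMeromorphicFun F}
  mul_mem' := IsMeromorphicFun.mul
  one_mem' := AnalyticAt.isMeromorphicFun fun _ => analyticAt_const
  add_mem' := IsMeromorphicFun.add
  zero_mem' := AnalyticAt.isMeromorphicFun fun _ => analyticAt_const
  neg_mem' := IsMeromorphicFun.neg

variable (E) in
/-- The ideal of meromorphic functions that vanish off a meagre set. -/
def genericallyZero : Ideal (meromorphicSubring E) where
  carrier := {F | ∀ᶠ u in residual E, F.1 u = 0}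
  add_mem' {F G} hF hG := by
    change ∀ᶠ u in residual E, F.1 u = 0 at hF
    change ∀ᶠ u in residual E, G.1 u = 0 at hG
    change ∀ᶠ u in residual E, (F + G).1 u = 0
    filter_upwards [hF, hG] with u hu hu'
    exact (congrArg₂ (· + ·) hu hu').trans (add_zero 0)
  zero_mem' := show ∀ᶠ u in residual E, (0 : E → ℂ) u = 0 from Eventually.of_forall fun _ => rfl
  smul_mem' F G hG := by
    change ∀ᶠ u in residual E, G.1 u = 0 at hG
    change ∀ᶠ u in residual E, (F • G).1 u = 0
    filter_upwards [hG] with u hu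
    exact (congrArg (F.1 u * ·) hu).trans (mul_zero _)

/-- By the identity theorem, a product of meromorphic functions vanishes generically only if one
of the factors does. -/
instance genericallyZero_isPrime [BaireSpace E] : (genericallyZero E).IsPrime where
  ne_top' := by
    rw [Ideal.ne_top_iff_one]
    intro h
    exact one_ne_zero (eq_zero_of_eventually_residual (F := fun _ : E => (1 : ℂ)) h
      (p := 0) continuousAt_const)
  mem_or_mem' {F G} h := by
    obtain ⟨p, hpF, hpG⟩ := (dense_of_mem_residual
      (inter_mem F.2.analyticAt_mem_residual G.2.analyticAt_mem_residual)).nonempty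
    by_cases hp : ∀ᶠ u in 𝓝 p, F.1 u = 0
    · exact Or.inl (IsMeromorphicFun.eventually_residual_eq_zero F.2 hp)
    · right
      obtain ⟨v, hv, hvF, hvG⟩ := ((not_eventually.1 hp).and_eventually
        (hpF.eventually_analyticAt.and hpG.eventually_analyticAt)).exists
      refine IsMeromorphicFun.eventually_residual_eq_zero G.2 (p₀ := v) ?_
      filter_upwards [hvF.continuousAt.eventually_ne hv, hvF.eventually_analyticAt,
        hvG.eventually_analyticAt] with u hu huF huG
      have : (F.1 * G.1) u = 0 :=
        eq_zero_of_eventually_residual h (huF.mul huG).continuousAt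
      exact (mul_eq_zero.1 this).resolve_left hu

end Meromorphic

/-- Uniqueness along the totally real subspace: a function that is holomorphic at `p` and vanishes
at all points `p + x` with `x` real and small vanishes near `p`.  A point `p + x + i y` lies on the
complex line `ζ ↦ p + x + ζ y`, along which the function vanishes for small real `ζ`. -/
theorem eventually_eq_zero_of_real {n : ℕ} {F : (Fin n → ℂ) → ℂ} {p : Fin n → ℂ}
    (hF : AnalyticAt ℂ F p)
    (h0 : ∀ᶠ x in 𝓝 (0 : Fin n → ℝ), F (p + fun i => (x i : ℂ)) = 0) :
    ∀ᶠ u in 𝓝 p, F u = 0 := by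
  obtain ⟨r, hr, hFr⟩ := Metric.eventually_nhds_iff_ball.1 hF.eventually_analyticAt
  obtain ⟨s, hs, h0s⟩ := Metric.eventually_nhds_iff_ball.1 h0
  have norm_ofReal (x : Fin n → ℝ) : ‖fun i => (x i : ℂ)‖ = ‖x‖ := by
    simp [Pi.norm_def]
  -- these radii keep `p + x + ζ y` in the ball of radius `r` for `‖ζ‖ < 2`, which includes `ζ = i`,
  -- and `x + t y` in the ball of radius `s` for real `t` with `|t| < 1`
  refine Metric.eventually_nhds_iff_ball.2 ⟨min (r / 3) (s / 2), by positivity, fun u hu => ?_⟩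
  rw [mem_ball_iff_norm, lt_min_iff] at hu
  set x : Fin n → ℝ := fun i => ((u - p) i).re with hx
  set y : Fin n → ℝ := fun i => ((u - p) i).im with hy
  have hxn : ‖x‖ ≤ ‖u - p‖ := (pi_norm_le_iff_of_nonneg (norm_nonneg _)).2 fun i =>
    (Complex.abs_re_le_norm _).trans (norm_le_pi_norm (u - p) i)
  have hyn : ‖y‖ ≤ ‖u - p‖ := (pi_norm_le_iff_of_nonneg (norm_nonneg _)).2 fun i =>
    (Complex.abs_im_le_norm _).trans (norm_le_pi_norm (u - p) i)
  set X : Fin n → ℂ := fun i => (x i : ℂ)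
  set Y : Fin n → ℂ := fun i => (y i : ℂ)
  have hXn : ‖X‖ ≤ ‖u - p‖ := (norm_ofReal x).trans_le hxn
  have hYn : ‖Y‖ ≤ ‖u - p‖ := (norm_ofReal y).trans_le hyn
  have hline : AnalyticOnNhd ℂ (fun ζ : ℂ => F (p + X + ζ • Y)) (Metric.ball 0 2) := by
    intro ζ hζ
    rw [mem_ball_zero_iff] at hζ
    refine AnalyticAt.fun_comp (g := F) (f := fun ζ : ℂ => p + X + ζ • Y) (hFr _ ?_) (by fun_prop)
    rw [mem_ball_iff_norm]
    calc ‖p + X + ζ • Y - p‖ = ‖X + ζ • Y‖ := by congr 1; abel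
      _ ≤ ‖X‖ + ‖ζ‖ * ‖Y‖ := (norm_add_le _ _).trans_eq (by rw [norm_smul])
      _ ≤ ‖u - p‖ + 2 * ‖u - p‖ := by gcongr
      _ < r := by linarith
  have hfreq : ∃ᶠ ζ in 𝓝[≠] (0 : ℂ), F (p + X + ζ • Y) = 0 := by
    have hT : Tendsto (fun t : ℝ => (t : ℂ)) (𝓝[≠] 0) (𝓝[≠] 0) := by
      refine tendsto_nhdsWithin_iff.2 ⟨?_, ?_⟩
      · exact (Complex.continuous_ofReal.tendsto' 0 0 Complex.ofReal_zero).mono_left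
          nhdsWithin_le_nhds
      · filter_upwards [self_mem_nhdsWithin] with t ht
        simpa using ht
    refine hT.frequently (Eventually.frequently ?_)
    have : ∀ᶠ t : ℝ in 𝓝[≠] 0, t ∈ Metric.ball (0 : ℝ) 1 :=
      nhdsWithin_le_nhds (Metric.ball_mem_nhds 0 one_pos)
    filter_upwards [this] with t ht
    rw [mem_ball_zero_iff] at ht
    have := h0s (x + t • y) (by
      rw [mem_ball_zero_iff]
      calc ‖x + t • y‖ ≤ ‖x‖ + ‖t‖ * ‖y‖ := (norm_add_le _ _).trans_eq (by rw [norm_smul])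
        _ ≤ ‖u - p‖ + 1 * ‖u - p‖ := by gcongr
        _ < s := by linarith)
    convert this using 2
    rw [add_assoc]
    congr 1
    ext i
    simp [X, Y]
  have := hline.eqOn_zero_of_preconnected_of_frequently_eq_zero
    (convex_ball _ _).isPreconnected (Metric.mem_ball_self two_pos) hfreq
    (show Complex.I ∈ Metric.ball (0 : ℂ) 2 by simp)
  refine Eq.trans ?_ this
  change F u = F (p + X + Complex.I • Y)
  congr 1
  ext i
  have := Complex.re_add_im ((u - p) i)
  simp only [Pi.add_apply, Pi.smul_apply, X, Y, hx, hy, smul_eq_mul, Pi.sub_apply] at this ⊢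
  linear_combination -this

/-! ### Algebraic dependence in a domain -/

theorem isAlgebraic_adjoin_of_eval₂_eq_zero {K D ι : Type*} [Field K] [CommRing D]
    [Algebra K D] {x : ι → D} (hx : AlgebraicIndependent K x) {y : D}
    {P : Polynomial (MvPolynomial ι K)} (hP : P ≠ 0)
    (h : P.eval₂ (MvPolynomial.eval₂Hom (algebraMap K D) x) y = 0) :
    IsAlgebraic (Algebra.adjoin K (range x)) y := by
  refine ⟨P.map (hx.aevalEquiv : MvPolynomial ι K →+* Algebra.adjoin K (range x)), ?_, ?_⟩
  · rwa [Ne, Polynomial.map_eq_zero_iff]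
    exact hx.aevalEquiv.injective
  · rw [Polynomial.aeval_def, Polynomial.eval₂_map]
    have hcomp : (algebraMap (Algebra.adjoin K (range x)) D).comp
        (hx.aevalEquiv : MvPolynomial ι K →+* Algebra.adjoin K (range x)) =
        MvPolynomial.eval₂Hom (algebraMap K D) x := ?_
    · rw [hcomp]
      exact h
    apply MvPolynomial.ringHom_ext <;> intro i
    · rw [MvPolynomial.coe_eval₂Hom, MvPolynomial.eval₂_C, ← MvPolynomial.algebraMap_eq]
      simp only [RingHom.comp_apply, RingHom.coe_coe, AlgEquiv.commutes]
      rfl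
    · simp

theorem exists_eval₂_eq_zero_of_isAlgebraic_adjoin {K D ι : Type*} [Field K] [CommRing D]
    [Algebra K D] {x : ι → D} {y : D}
    (h : IsAlgebraic (Algebra.adjoin K (range x)) y) :
    ∃ P : Polynomial (MvPolynomial ι K), 0 < P.natDegree ∧
      P.eval₂ (MvPolynomial.eval₂Hom (algebraMap K D) x) y = 0 := by
  obtain ⟨q, hq0, hq⟩ := h
  have hdeg : 0 < q.natDegree := by
    by_contra h0
    obtain ⟨c, hc⟩ := Polynomial.natDegree_eq_zero.1 (Nat.eq_zero_of_not_pos h0)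
    rw [← hc, Polynomial.aeval_C] at hq
    apply hq0
    have hc0 : c = 0 := Subtype.ext hq
    rw [← hc, hc0, Polynomial.C_0]
  let e : MvPolynomial ι K →ₐ[K] Algebra.adjoin K (range x) :=
    MvPolynomial.aeval fun i => ⟨x i, Algebra.subset_adjoin ⟨i, rfl⟩⟩
  have he : Function.Surjective e := by
    have h1 : (Algebra.adjoin K (range x)).val.comp e = MvPolynomial.aeval x := by
      ext; simp [e]
    rintro ⟨a, ha⟩
    rw [Algebra.adjoin_range_eq_range_aeval] at ha
    obtain ⟨b, hb⟩ := ha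
    exact ⟨b, Subtype.ext ((DFunLike.congr_fun h1 b).trans hb)⟩
  obtain ⟨P, rfl⟩ := (Polynomial.mem_lifts q).1
    (Polynomial.mem_lifts_of_surjective (f := (e : MvPolynomial ι K →+* _)) he q)
  refine ⟨P, hdeg.trans_le Polynomial.natDegree_map_le, ?_⟩
  rw [Polynomial.aeval_def, Polynomial.eval₂_map] at hq
  have hcomp : MvPolynomial.eval₂Hom (algebraMap K D) x =
      (algebraMap (Algebra.adjoin K (range x)) D).comp
        (e : MvPolynomial ι K →+* Algebra.adjoin K (range x)) := ?_
  · rw [hcomp]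
    exact hq
  apply MvPolynomial.ringHom_ext <;> intro i
  · rw [MvPolynomial.coe_eval₂Hom, MvPolynomial.eval₂_C, ← MvPolynomial.algebraMap_eq]
    simp only [RingHom.comp_apply, RingHom.coe_coe, AlgHom.commutes]
    rfl
  · simp [e]

theorem isAlgebraic_adjoin_trans {K D ι κ : Type*} [Field K] [CommRing D] [IsDomain D]
    [Algebra K D] {x : ι → D} {y : κ → D} {z : D}
    (hy : ∀ j, IsAlgebraic (Algebra.adjoin K (range x)) (y j))
    (hz : IsAlgebraic (Algebra.adjoin K (range y)) z) :
    IsAlgebraic (Algebra.adjoin K (range x)) z := by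
  refine hz.adjoin_of_forall_isAlgebraic ?_
  rintro _ ⟨⟨j, rfl⟩, -⟩
  exact hy j

open AlgebraicIndependent in
theorem isAlgebraic_adjoin_exchange {K D ι : Type*} [Field K] [CommRing D] [IsDomain D]
    [Algebra K D] [Finite ι] {x y : ι → D} (hx : AlgebraicIndependent K x)
    (hy : AlgebraicIndependent K y)
    (h : ∀ j, IsAlgebraic (Algebra.adjoin K (range x)) (y j)) (i : ι) :
    IsAlgebraic (Algebra.adjoin K (range y)) (x i) := by
  have hxi : (matroid K D).Indep (range x) := matroid_indep_iff.2 hx.coe_range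
  have hyi : (matroid K D).Indep (range y) := matroid_indep_iff.2 hy.coe_range
  have hsub : range y ⊆ (matroid K D).closure (range x) := by
    rw [matroid_closure_eq]
    rintro _ ⟨j, rfl⟩
    exact h j
  obtain ⟨B, hB, hyB⟩ := hyi.subset_isBasis_of_subset hsub
  have hcard : B.encard = (range y).encard := by
    rw [hB.encard_eq_encard hxi.isBasis_closure, ← image_univ, ← image_univ,
      hx.injective.encard_image, hy.injective.encard_image]
  have hBy : range y = B := (finite_range y).eq_of_subset_of_encard_le hyB hcard.le
  have hmem : x i ∈ (matroid K D).closure (range y) := by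
    rw [hBy, hB.closure_eq_closure, Matroid.closure_closure]
    exact (matroid K D).subset_closure _ (subset_univ _) ⟨i, rfl⟩
  rw [matroid_closure_eq] at hmem
  exact hmem

/-! ### Polynomial relations between meromorphic maps -/

section MeromorphicRing

variable {E : Type*} [NormedAddCommGroup E] [NormedSpace ℂ E]

variable (E) in
/-- Meromorphic functions modulo equality off a meagre set. -/
def MeromorphicRing : Type _ := meromorphicSubring E ⧸ genericallyZero E

instance : CommRing (MeromorphicRing E) :=
  inferInstanceAs (CommRing (meromorphicSubring E ⧸ genericallyZero E))

instance [BaireSpace E] : IsDomain (MeromorphicRing E) :=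
  inferInstanceAs (IsDomain (meromorphicSubring E ⧸ genericallyZero E))

variable (E) in
/-- The quotient map onto the ring of meromorphic functions modulo generic equality. -/
def meromorphicMk : meromorphicSubring E →+* MeromorphicRing E :=
  Ideal.Quotient.mk (genericallyZero E)

theorem meromorphicMk_eq_zero_iff {F : meromorphicSubring E} :
    meromorphicMk E F = 0 ↔ ∀ᶠ u in residual E, F.1 u = 0 :=
  Ideal.Quotient.eq_zero_iff_mem

variable (E) in
/-- Constants as meromorphic functions. -/
def meromorphicConst : ℂ →+* meromorphicSubring E :=
  (Pi.constRingHom E ℂ).codRestrict (meromorphicSubring E) fun _ =>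
    AnalyticAt.isMeromorphicFun fun _ => analyticAt_const

instance {𝕂 : Type*} [RCLike 𝕂] : Algebra 𝕂 (MeromorphicRing E) :=
  ((meromorphicMk E).comp ((meromorphicConst E).comp (toComplex 𝕂))).toAlgebra

end MeromorphicRing

theorem map_eval₂_eval₂Hom {K R S ι : Type*} [CommRing K] [CommRing R] [CommRing S]
    (φ : R →+* S) (j : K →+* R) (x : ι → R) (y : R) (P : Polynomial (MvPolynomial ι K)) :
    φ (P.eval₂ (MvPolynomial.eval₂Hom j x) y) =
      P.eval₂ (MvPolynomial.eval₂Hom (φ.comp j) (φ ∘ x)) (φ y) := by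
  rw [Polynomial.hom_eval₂]
  congr 1
  apply MvPolynomial.ringHom_ext <;> simp

theorem AnalyticAt.eval₂_eval₂Hom {K E ι : Type*} [Field K] [NormedAddCommGroup E]
    [NormedSpace ℂ E] (j : K →+* ℂ) {f : E → ι → ℂ} {h : E → ℂ} {p : E}
    (hf : ∀ i, AnalyticAt ℂ (fun u => f u i) p) (hh : AnalyticAt ℂ h p)
    (P : Polynomial (MvPolynomial ι K)) :
    AnalyticAt ℂ (fun u => P.eval₂ (MvPolynomial.eval₂Hom j (f u)) (h u)) p := by
  have hcoeff (Q : MvPolynomial ι K) :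
      AnalyticAt ℂ (fun u => MvPolynomial.eval₂Hom j (f u) Q) p := by
    induction Q using MvPolynomial.induction_on with
    | C a => simpa using analyticAt_const
    | add q r hq hr => simpa using hq.fun_add hr
    | mul_X q i hq => simpa using hq.fun_mul (hf i)
  induction P using Polynomial.induction_on' with
  | add q r hq hr => simpa [Polynomial.eval₂_add] using hq.fun_add hr
  | monomial k a => simpa [Polynomial.eval₂_monomial] using (hcoeff a).fun_mul (hh.fun_pow k)

section Generic

variable {n : ℕ} {ι κ μ : Type*}

theorem IsMeromorphicMap.component {f : (Fin n → ℂ) → κ → ℂ} (hf : IsMeromorphicMap f) (i : κ) :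
    IsMeromorphicFun fun u => f u i :=
  fun p => hf p i

/-- The components of a meromorphic map, modulo generic equality. -/
def IsMeromorphicMap.toRing {f : (Fin n → ℂ) → κ → ℂ} (hf : IsMeromorphicMap f) (i : κ) :
    MeromorphicRing (Fin n → ℂ) :=
  meromorphicMk _ ⟨fun u => f u i, hf.component i⟩

theorem IsMeromorphicMap.holoDomain_mem_residual [Fintype κ] {f : (Fin n → ℂ) → κ → ℂ}
    (hf : IsMeromorphicMap f) : holoDomain f ∈ residual (Fin n → ℂ) := by
  have : holoDomain f = ⋂ i, {u | AnalyticAt ℂ (fun u => f u i) u} := by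
    ext u
    simp only [holoDomain, mem_ofPred_eq, mem_iInter]
    exact analyticAt_pi_iff
  rw [this, iInter_mem]
  exact fun i => (hf.component i).analyticAt_mem_residual

/-- `h` is algebraic over `𝕂(f)` off a meagre set. -/
def GenericallyAlgebraicOver (𝕂 : Type*) [RCLike 𝕂] (h : (Fin n → ℂ) → κ → ℂ)
    (f : (Fin n → ℂ) → ι → ℂ) : Prop :=
  ∀ i, ∃ P : Polynomial (MvPolynomial ι 𝕂), 0 < P.natDegree ∧ ∀ᶠ u in residual (Fin n → ℂ),
    P.eval₂ (MvPolynomial.eval₂Hom (toComplex 𝕂) (f u)) (h u i) = 0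

/-- No non-trivial polynomial relation over `𝕂` holds between the components of `f` off a meagre
set. -/
def GenericallyIndependent (𝕂 : Type*) [RCLike 𝕂] (f : (Fin n → ℂ) → ι → ℂ) : Prop :=
  ∀ Q : MvPolynomial ι 𝕂,
    (∀ᶠ u in residual (Fin n → ℂ), Q.eval₂ (toComplex 𝕂) (f u) = 0) → Q = 0

variable {𝕂 : Type*} [RCLike 𝕂] {f : (Fin n → ℂ) → ι → ℂ} {h : (Fin n → ℂ) → κ → ℂ}

/-- A polynomial in meromorphic functions is meromorphic, and its class is the polynomial in the
classes. -/
theorem exists_meromorphicSubring_eval₂ (hf : IsMeromorphicMap f) (hh : IsMeromorphicMap h) (i : κ)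
    (P : Polynomial (MvPolynomial ι 𝕂)) :
    ∃ F : meromorphicSubring (Fin n → ℂ),
      (∀ u, F.1 u = P.eval₂ (MvPolynomial.eval₂Hom (toComplex 𝕂) (f u)) (h u i)) ∧
      meromorphicMk _ F = P.eval₂
        (MvPolynomial.eval₂Hom (algebraMap 𝕂 (MeromorphicRing (Fin n → ℂ))) hf.toRing)
        (hh.toRing i) := by
  let x : ι → meromorphicSubring (Fin n → ℂ) := fun k => ⟨fun u => f u k, hf.component k⟩
  let y : meromorphicSubring (Fin n → ℂ) := ⟨fun u => h u i, hh.component i⟩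
  let j : 𝕂 →+* meromorphicSubring (Fin n → ℂ) := (meromorphicConst _).comp (toComplex 𝕂)
  exact ⟨P.eval₂ (MvPolynomial.eval₂Hom j x) y, fun u =>
    map_eval₂_eval₂Hom ((Pi.evalRingHom (fun _ : Fin n → ℂ => ℂ) u).comp
      (meromorphicSubring (Fin n → ℂ)).subtype) j x y P,
    map_eval₂_eval₂Hom (meromorphicMk (Fin n → ℂ)) j x y P⟩

/-- A polynomial relation holds generically if and only if it holds in the ring of meromorphic
functions. -/
theorem eval₂_toRing_eq_zero_iff (hf : IsMeromorphicMap f) (hh : IsMeromorphicMap h) (i : κ)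
    (P : Polynomial (MvPolynomial ι 𝕂)) :
    P.eval₂ (MvPolynomial.eval₂Hom (algebraMap 𝕂 (MeromorphicRing (Fin n → ℂ))) hf.toRing)
        (hh.toRing i) = 0 ↔
      ∀ᶠ u in residual (Fin n → ℂ),
        P.eval₂ (MvPolynomial.eval₂Hom (toComplex 𝕂) (f u)) (h u i) = 0 := by
  obtain ⟨F, hF, hP⟩ := exists_meromorphicSubring_eval₂ hf hh i P
  rw [← hP, meromorphicMk_eq_zero_iff]
  simp only [hF]

theorem GenericallyIndependent.algebraicIndependent (hf : IsMeromorphicMap f)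
    (hi : GenericallyIndependent 𝕂 f) : AlgebraicIndependent 𝕂 hf.toRing := by
  refine (algebraicIndependent_iff).2 fun Q hQ => hi Q ?_
  -- `Q` is regarded as a polynomial of degree `0` in an auxiliary variable
  have hm : IsMeromorphicMap fun (_ : Fin n → ℂ) (_ : Unit) => (0 : ℂ) :=
    fun p _ => AnalyticAt.isMeromorphicFun (fun _ => analyticAt_const) p
  have := (eval₂_toRing_eq_zero_iff hf hm () (Polynomial.C Q)).1 (by
    rw [Polynomial.eval₂_C]
    exact hQ)
  simpa [Polynomial.eval₂_C] using this

theorem GenericallyAlgebraicOver.isAlgebraic (hf : IsMeromorphicMap f)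
    (hi : GenericallyIndependent 𝕂 f) (hh : IsMeromorphicMap h)
    (H : GenericallyAlgebraicOver 𝕂 h f) (i : κ) :
    IsAlgebraic (Algebra.adjoin 𝕂 (range hf.toRing)) (hh.toRing i) := by
  obtain ⟨P, hP, hz⟩ := H i
  exact isAlgebraic_adjoin_of_eval₂_eq_zero (hi.algebraicIndependent hf)
    (Polynomial.ne_zero_of_natDegree_gt hP) ((eval₂_toRing_eq_zero_iff hf hh i P).2 hz)

theorem genericallyAlgebraicOver_of_isAlgebraic (hf : IsMeromorphicMap f)
    (hh : IsMeromorphicMap h)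
    (H : ∀ i, IsAlgebraic (Algebra.adjoin 𝕂 (range hf.toRing)) (hh.toRing i)) :
    GenericallyAlgebraicOver 𝕂 h f := by
  intro i
  obtain ⟨P, hP, hz⟩ := exists_eval₂_eq_zero_of_isAlgebraic_adjoin (H i)
  exact ⟨P, hP, (eval₂_toRing_eq_zero_iff hf hh i P).1 hz⟩

theorem GenericallyAlgebraicOver.trans {k : (Fin n → ℂ) → μ → ℂ} (hf : IsMeromorphicMap f)
    (hfi : GenericallyIndependent 𝕂 f) (hh : IsMeromorphicMap h)
    (hhi : GenericallyIndependent 𝕂 h) (hk : IsMeromorphicMap k)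
    (hkh : GenericallyAlgebraicOver 𝕂 k h) (hhf : GenericallyAlgebraicOver 𝕂 h f) :
    GenericallyAlgebraicOver 𝕂 k f :=
  genericallyAlgebraicOver_of_isAlgebraic hf hk fun i =>
    isAlgebraic_adjoin_trans (hhf.isAlgebraic hf hfi hh) (hkh.isAlgebraic hh hhi hk i)

/-- Two independent families of the same finite length: if one is algebraic over the other, then
so is the other over the first, by comparison of transcendence degrees. -/
theorem GenericallyAlgebraicOver.exchange [Finite ι] {h : (Fin n → ℂ) → ι → ℂ}
    (hf : IsMeromorphicMap f) (hfi : GenericallyIndependent 𝕂 f) (hh : IsMeromorphicMap h)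
    (hhi : GenericallyIndependent 𝕂 h) (hhf : GenericallyAlgebraicOver 𝕂 h f) :
    GenericallyAlgebraicOver 𝕂 f h :=
  genericallyAlgebraicOver_of_isAlgebraic hh hf <| isAlgebraic_adjoin_exchange
    (hfi.algebraicIndependent hf) (hhi.algebraicIndependent hh) (hhf.isAlgebraic hf hfi hh)

theorem GenericallyAlgebraicOver.comp_homeomorph (H : GenericallyAlgebraicOver 𝕂 h f)
    (A : (Fin n → ℂ) ≃ₜ (Fin n → ℂ)) : GenericallyAlgebraicOver 𝕂 (h ∘ A) (f ∘ A) := fun i =>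
  let ⟨P, hP, hz⟩ := H i
  ⟨P, hP, (tendsto_residual_of_isOpenMap A.continuous A.isOpenMap).eventually hz⟩

theorem GenericallyIndependent.comp_homeomorph (H : GenericallyIndependent 𝕂 f)
    (A : (Fin n → ℂ) ≃ₜ (Fin n → ℂ)) : GenericallyIndependent 𝕂 (f ∘ A) := by
  refine fun Q hQ => H Q ?_
  have := (tendsto_residual_of_isOpenMap A.symm.continuous A.symm.isOpenMap).eventually hQ
  simpa using this

theorem IsMeromorphicMap.comp_homeomorph (hf : IsMeromorphicMap f)
    (A : (Fin n → ℂ) ≃ₜ (Fin n → ℂ)) (hA : ∀ p, AnalyticAt ℂ A p) : IsMeromorphicMap (f ∘ A) :=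
  fun p i => (hf.component i).comp_homeomorph A hA p

section Holo

variable [Fintype ι] [Fintype κ]

theorem analyticAt_component_of_mem_holoDomain {u : Fin n → ℂ} (hu : u ∈ holoDomain f) (i : ι) :
    AnalyticAt ℂ (fun v => f v i) u :=
  (analyticAt_pi_iff).1 hu i

/-- Generic relations hold at every point where both maps are holomorphic, by continuity. -/
theorem GenericallyAlgebraicOver.meromorphicAlgebraicOver (H : GenericallyAlgebraicOver 𝕂 h f) :
    MeromorphicAlgebraicOver 𝕂 h f := by
  intro i
  obtain ⟨P, hP, hz⟩ := H i
  refine ⟨P, hP, fun u hu => eq_zero_of_eventually_residual hz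
    (AnalyticAt.continuousAt (𝕜 := ℂ) ?_)⟩
  exact AnalyticAt.eval₂_eval₂Hom _ (analyticAt_component_of_mem_holoDomain hu.2)
    (analyticAt_component_of_mem_holoDomain hu.1 i) P

theorem MeromorphicAlgebraicOver.genericallyAlgebraicOver (hf : IsMeromorphicMap f)
    (hh : IsMeromorphicMap h) (H : MeromorphicAlgebraicOver 𝕂 h f) :
    GenericallyAlgebraicOver 𝕂 h f := by
  intro i
  obtain ⟨P, hP, hz⟩ := H i
  refine ⟨P, hP, ?_⟩
  filter_upwards [hh.holoDomain_mem_residual, hf.holoDomain_mem_residual] with u hu hu'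
  exact hz u ⟨hu, hu'⟩

theorem AdmitsAAT.genericallyIndependent {f : (Fin n → ℂ) → Fin n → ℂ} (H : AdmitsAAT 𝕂 f) :
    GenericallyIndependent 𝕂 f := by
  refine fun Q hQ => H.independent Q (Eventually.of_forall fun u hu => ?_)
  refine eq_zero_of_eventually_residual hQ (AnalyticAt.continuousAt (𝕜 := ℂ) ?_)
  simpa [Polynomial.eval₂_C] using AnalyticAt.eval₂_eval₂Hom (toComplex 𝕂) (h := 0)
    (analyticAt_component_of_mem_holoDomain hu) analyticAt_const (Polynomial.C Q)

theorem toComplex_ofReal (r : ℝ) : toComplex 𝕂 (r : 𝕂) = (r : ℂ) := by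
  apply Complex.ext <;> simp [toComplex]

theorem toComplexVec_add (u v : Fin n → 𝕂) :
    toComplexVec (u + v) = toComplexVec u + toComplexVec v :=
  funext fun i => map_add (toComplex 𝕂) (u i) (v i)

/-- A relation that holds on a non-empty open subset of `𝕂 ^ n`, at points where both maps are
holomorphic, holds generically on `ℂ ^ n`.  For `𝕂 = ℝ` this uses that `ℝ ^ n` is totally real in
`ℂ ^ n`. -/
theorem genericallyAlgebraicOver_of_isOpen (hf : IsMeromorphicMap f) (hh : IsMeromorphicMap h)
    {O : Set (Fin n → 𝕂)} (hO : IsOpen O) (hne : O.Nonempty)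
    (hhol : ∀ u ∈ O, toComplexVec u ∈ holoDomain h ∩ holoDomain f)
    (H : ∀ i, ∃ P : Polynomial (MvPolynomial ι 𝕂), 0 < P.natDegree ∧ ∀ u ∈ O,
      P.eval₂ (MvPolynomial.eval₂Hom (toComplex 𝕂) (f (toComplexVec u))) (h (toComplexVec u) i)
        = 0) :
    GenericallyAlgebraicOver 𝕂 h f := by
  intro i
  obtain ⟨P, hP, hz⟩ := H i
  refine ⟨P, hP, ?_⟩
  obtain ⟨u₀, hu₀⟩ := hne
  have han : AnalyticAt ℂ (fun u => P.eval₂ (MvPolynomial.eval₂Hom (toComplex 𝕂) (f u)) (h u i))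
      (toComplexVec u₀) :=
    AnalyticAt.eval₂_eval₂Hom _ (analyticAt_component_of_mem_holoDomain (hhol u₀ hu₀).2)
      (analyticAt_component_of_mem_holoDomain (hhol u₀ hu₀).1 i) P
  refine IsMeromorphicFun.eventually_residual_eq_zero ?_ (eventually_eq_zero_of_real han ?_)
  · obtain ⟨F, hF, -⟩ := exists_meromorphicSubring_eval₂ hf hh i P
    exact (funext hF : F.1 = _) ▸ F.2
  · have hc : Tendsto (fun x : Fin n → ℝ => u₀ + fun i => (x i : 𝕂)) (𝓝 0) (𝓝 u₀) := by
      refine Continuous.tendsto' ?_ 0 u₀ (by ext; simp)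
      fun_prop
    filter_upwards [hc.eventually (hO.mem_nhds hu₀)] with x hx
    have := hz _ hx
    rwa [toComplexVec_add, show (toComplexVec fun i => (x i : 𝕂)) = fun i => (x i : ℂ) from
      funext fun i => toComplex_ofReal (x i)] at this

end Holo

end Generic

/-! ### Affine changes of coordinates and translates of charts -/

section Charts

variable {𝕂 : Type*} [RCLike 𝕂] {n : ℕ}

/-- Translation of `ℂ ^ n` by a vector of `𝕂 ^ n`. -/
def shift (t : Fin n → 𝕂) : (Fin n → ℂ) ≃ₜ (Fin n → ℂ) :=
  Homeomorph.addRight (toComplexVec t)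

theorem shift_apply (t : Fin n → 𝕂) (u : Fin n → ℂ) : shift t u = u + toComplexVec t := rfl

theorem shift_toComplexVec (t u : Fin n → 𝕂) :
    shift t (toComplexVec u) = toComplexVec (u + t) :=
  (toComplexVec_add u t).symm

theorem shift_comp_shift (s t : Fin n → 𝕂) : shift s ∘ shift t = shift (t + s) := by
  ext u : 1
  simp [shift_apply, toComplexVec_add, add_assoc]

theorem shift_zero : ⇑(shift (0 : Fin n → 𝕂)) = id := by
  ext u i
  simp [shift_apply, toComplexVec]

theorem analyticAt_shift (t : Fin n → 𝕂) (p : Fin n → ℂ) : AnalyticAt ℂ (shift t) p :=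
  analyticAt_id.add analyticAt_const

theorem mem_holoDomain_comp {f : (Fin n → ℂ) → Fin n → ℂ} {A : (Fin n → ℂ) → (Fin n → ℂ)}
    {u : Fin n → ℂ} (hA : AnalyticAt ℂ A u) (hu : A u ∈ holoDomain f) : u ∈ holoDomain (f ∘ A) :=
  AnalyticAt.comp hu hA

/-- The translate to `c` of the chart `φ`. -/
def translatedChart (φ : OpenPartialHomeomorph (Fin n → 𝕂) (Fin n → 𝕂)) (c : Fin n → 𝕂) :
    OpenPartialHomeomorph (Fin n → 𝕂) (Fin n → 𝕂) :=
  (Homeomorph.addLeft (-c)).transOpenPartialHomeomorph φ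

variable {φ ψ : OpenPartialHomeomorph (Fin n → 𝕂) (Fin n → 𝕂)}

theorem translatedChart_mem (c : Fin n → 𝕂) : translatedChart φ c ∈ translatedAtlas φ := ⟨c, rfl⟩

theorem mem_translatedChart_source {c u : Fin n → 𝕂} :
    u ∈ (translatedChart φ c).source ↔ -c + u ∈ φ.source := Iff.rfl

theorem translatedChart_symm_apply (c x : Fin n → 𝕂) :
    (translatedChart φ c).symm x = c + φ.symm x := by
  change -(-c) + φ.symm x = _
  rw [neg_neg]

theorem map_eval₂_toComplex {ι : Type*} (P : Polynomial (MvPolynomial ι 𝕂)) (x : ι → 𝕂) (y : 𝕂) :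
    toComplex 𝕂 (P.eval₂ (MvPolynomial.eval₂Hom (RingHom.id 𝕂) x) y) =
      P.eval₂ (MvPolynomial.eval₂Hom (toComplex 𝕂) fun i => toComplex 𝕂 (x i))
        (toComplex 𝕂 y) :=
  map_eval₂_eval₂Hom (toComplex 𝕂) (RingHom.id 𝕂) x y P

variable {f g : (Fin n → ℂ) → Fin n → ℂ} {a b : Fin n → 𝕂}

/-- A relation between translates of charts, on a non-empty open subset of `𝕂 ^ n`, is a relation
between meromorphic maps. -/
theorem genericallyAlgebraicOver_of_charts (hf : IsMeromorphicMap f) (hg : IsMeromorphicMap g)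
    (hφ : ∀ u ∈ φ.source,
      toComplexVec (u + a) ∈ holoDomain f ∧ toComplexVec (φ u) = f (toComplexVec (u + a)))
    (hψ : ∀ u ∈ ψ.source,
      toComplexVec (u + b) ∈ holoDomain g ∧ toComplexVec (ψ u) = g (toComplexVec (u + b)))
    (A : (Fin n → ℂ) ≃ₜ (Fin n → ℂ)) (hA : ∀ p, AnalyticAt ℂ A p)
    {L : (Fin n → 𝕂) → (Fin n → 𝕂)} (hL : ∀ u, A (toComplexVec u) = toComplexVec (L u))
    {c d : Fin n → 𝕂} {W : Set (Fin n → 𝕂)} (hW : IsOpen W) (hne : W.Nonempty)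
    (hWφ : ∀ u ∈ W, -c + u ∈ φ.source) (hWψ : ∀ u ∈ W, -d + L u ∈ ψ.source)
    (H : ∀ i, ∃ P : Polynomial (MvPolynomial (Fin n) 𝕂), 0 < P.natDegree ∧ ∀ u ∈ W,
      P.eval₂ (MvPolynomial.eval₂Hom (RingHom.id 𝕂) (φ (-c + u))) (ψ (-d + L u) i) = 0) :
    GenericallyAlgebraicOver 𝕂 (g ∘ shift (b - d) ∘ A) (f ∘ shift (a - c)) := by
  have e1 (u : Fin n → 𝕂) : shift (a - c) (toComplexVec u) = toComplexVec (-c + u + a) := by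
    rw [shift_toComplexVec]; congr 1; abel
  have e2 (u : Fin n → 𝕂) : shift (b - d) (A (toComplexVec u)) = toComplexVec (-d + L u + b) := by
    rw [hL, shift_toComplexVec]; congr 1; abel
  have hB (p : Fin n → ℂ) : AnalyticAt ℂ (shift (b - d) ∘ A) p :=
    (analyticAt_shift _ _).comp (hA p)
  refine genericallyAlgebraicOver_of_isOpen (hf.comp_homeomorph _ (analyticAt_shift _))
    (hg.comp_homeomorph (A.trans (shift (b - d))) hB) hW hne (fun u hu => ⟨?_, ?_⟩) fun i => ?_
  · refine mem_holoDomain_comp (hB _) ?_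
    rw [Function.comp_apply, e2]
    exact (hψ _ (hWψ u hu)).1
  · refine mem_holoDomain_comp (analyticAt_shift _ _) ?_
    rw [e1]
    exact (hφ _ (hWφ u hu)).1
  · obtain ⟨P, hP, hz⟩ := H i
    refine ⟨P, hP, fun u hu => ?_⟩
    have := congrArg (toComplex 𝕂) (hz u hu)
    rw [map_eval₂_toComplex, map_zero] at this
    simp only [Function.comp_apply, e1, e2]
    rw [← (hφ _ (hWφ u hu)).2, ← (hψ _ (hWψ u hu)).2]
    exact this

/-- All translates of `f` by vectors of `𝕂 ^ n` are algebraic over `𝕂(f)`.  For small vectors this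
is the compatibility of two overlapping charts; the general case follows by transitivity, as every
vector is a multiple of a small one. -/
theorem genericallyAlgebraicOver_shift (hf : IsMeromorphicMap f)
    (hi : GenericallyIndependent 𝕂 f) (hφ : IsShiftChart f φ)
    (hatlas : IsNashAtlas (translatedAtlas φ)) (t : Fin n → 𝕂) :
    GenericallyAlgebraicOver 𝕂 (f ∘ shift t) f := by
  obtain ⟨a, ha⟩ := hφ.eq_shift
  have hsmall (c : Fin n → 𝕂) (hc : c ∈ φ.source) :
      GenericallyAlgebraicOver 𝕂 (f ∘ shift (-c)) f := by
    have key := hatlas.compatible _ (translatedChart_mem 0) _ (translatedChart_mem c)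
    -- the point `c` lies in the domains of both charts, so that their overlap is not empty
    have h1 := genericallyAlgebraicOver_of_charts hf hf ha ha (Homeomorph.refl _)
      (fun p => analyticAt_id) (L := id) (fun u => rfl) (c := 0) (d := c)
      (W := (translatedChart φ 0).source ∩ (translatedChart φ c).source)
      ((translatedChart φ 0).open_source.inter (translatedChart φ c).open_source)
      ⟨c, by simpa [mem_translatedChart_source] using ⟨hc, hφ.zero_mem⟩⟩
      (fun u hu => hu.1) (fun u hu => hu.2) (fun i => by
        obtain ⟨P, hP, hz⟩ := key.algebraic i
        refine ⟨P, hP, fun u hu => ?_⟩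
        have := hz _ (mem_image_of_mem _ hu)
        rwa [Function.comp_apply, (translatedChart φ 0).left_inv hu.1] at this)
    have h2 := h1.comp_homeomorph (shift (-a))
    have e1 : (f ∘ shift (a - c) ∘ Homeomorph.refl (Fin n → ℂ)) ∘ shift (-a) =
        f ∘ shift (-c) := by
      change f ∘ (shift (a - c) ∘ shift (-a)) = _
      rw [shift_comp_shift]; congr 3; abel
    have e2 : (f ∘ shift (a - 0)) ∘ shift (-a) = f := by
      rw [Function.comp_assoc, shift_comp_shift]
      simp [shift_zero]
    rwa [e1, e2] at h2
  have hadd (s t : Fin n → 𝕂) (hs : GenericallyAlgebraicOver 𝕂 (f ∘ shift s) f)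
      (ht : GenericallyAlgebraicOver 𝕂 (f ∘ shift t) f) :
      GenericallyAlgebraicOver 𝕂 (f ∘ shift (s + t)) f := by
    have hs' := hs.comp_homeomorph (shift t)
    rw [Function.comp_assoc, shift_comp_shift, add_comm] at hs'
    exact GenericallyAlgebraicOver.trans hf hi (hf.comp_homeomorph _ (analyticAt_shift t))
      (hi.comp_homeomorph _) (hf.comp_homeomorph _ (analyticAt_shift _)) hs' ht
  have hlim : Tendsto (fun N : ℕ => -((N : 𝕂)⁻¹ • t)) atTop (𝓝 0) := by
    have := (tendsto_inv_atTop_nhds_zero_nat (𝕜 := 𝕂)).smul_const t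
    simpa using this.neg
  obtain ⟨N, hN, hN0⟩ := ((hlim.eventually (φ.open_source.mem_nhds hφ.zero_mem)).and
    (eventually_ge_atTop 1)).exists
  have hmul (k : ℕ) (hk : 1 ≤ k) :
      GenericallyAlgebraicOver 𝕂 (f ∘ shift (k • ((N : 𝕂)⁻¹ • t))) f := by
    induction k, hk using Nat.le_induction with
    | base => simpa using hsmall _ hN
    | succ k _ ih =>
      rw [succ_nsmul]
      exact hadd _ _ ih (by simpa using hsmall _ hN)
  have hNt : N • ((N : 𝕂)⁻¹ • t) = t := by
    rw [← Nat.cast_smul_eq_nsmul 𝕂, smul_smul,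
      mul_inv_cancel₀ (Nat.cast_ne_zero.2 (Nat.one_le_iff_ne_zero.1 hN0)), one_smul]
  simpa only [hNt] using hmul N hN0

theorem genericallyAlgebraicOver_shift_shift (hf : IsMeromorphicMap f)
    (hi : GenericallyIndependent 𝕂 f) (hφ : IsShiftChart f φ)
    (hatlas : IsNashAtlas (translatedAtlas φ)) (s t : Fin n → 𝕂) :
    GenericallyAlgebraicOver 𝕂 (f ∘ shift s) (f ∘ shift t) := by
  have := (genericallyAlgebraicOver_shift hf hi hφ hatlas (s - t)).comp_homeomorph (shift t)
  rwa [Function.comp_assoc, shift_comp_shift, add_sub_cancel] at this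

/-- The action of `GL_n(𝕂)` on `ℂ ^ n` by homeomorphisms. -/
def glHomeomorph (α : GL (Fin n) 𝕂) : (Fin n → ℂ) ≃ₜ (Fin n → ℂ) where
  toFun := glAct α
  invFun := glAct α⁻¹
  left_inv u := by
    rw [glAct, glAct, Matrix.mulVec_mulVec, ← Matrix.map_mul, ← Units.val_mul]
    simp
  right_inv u := by
    rw [glAct, glAct, Matrix.mulVec_mulVec, ← Matrix.map_mul, ← Units.val_mul]
    simp
  continuous_toFun := by unfold glAct; fun_prop
  continuous_invFun := by unfold glAct; fun_prop

theorem analyticAt_glHomeomorph (α : GL (Fin n) 𝕂) (p : Fin n → ℂ) :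
    AnalyticAt ℂ (glHomeomorph α) p :=
  (LinearMap.toContinuousLinearMap
    (((α : Matrix (Fin n) (Fin n) 𝕂).map (toComplex 𝕂)).mulVecLin)).analyticAt p

/-- The action of `GL_n(𝕂)` on `𝕂 ^ n`. -/
def glLinear (α : GL (Fin n) 𝕂) : (Fin n → 𝕂) →L[𝕂] (Fin n → 𝕂) :=
  LinearMap.toContinuousLinearMap (α : Matrix (Fin n) (Fin n) 𝕂).mulVecLin

theorem glHomeomorph_toComplexVec (α : GL (Fin n) 𝕂) (u : Fin n → 𝕂) :
    glHomeomorph α (toComplexVec u) = toComplexVec (glLinear α u) := by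
  ext i
  change ((((α : Matrix (Fin n) (Fin n) 𝕂).map (toComplex 𝕂))).mulVec (toComplexVec u)) i =
    toComplex 𝕂 ((α : Matrix (Fin n) (Fin n) 𝕂).mulVec u i)
  simp [Matrix.mulVec, dotProduct, toComplexVec, map_sum]

theorem glHomeomorph_comp_shift (α : GL (Fin n) 𝕂) (t : Fin n → 𝕂) :
    glHomeomorph α ∘ shift t = shift (glLinear α t) ∘ glHomeomorph α := by
  ext u : 1
  simp only [Function.comp_apply, shift_apply, ← glHomeomorph_toComplexVec]
  exact ((α : Matrix (Fin n) (Fin n) 𝕂).map (toComplex 𝕂)).mulVec_add _ _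

/-- Algebraicity of `g ∘ α` over `𝕂(f)` does not depend on translates of the two maps. -/
theorem genericallyAlgebraicOver_shift_iff (hf : IsMeromorphicMap f)
    (hfi : GenericallyIndependent 𝕂 f) (hg : IsMeromorphicMap g)
    (hgi : GenericallyIndependent 𝕂 g) (hψ : IsShiftChart g ψ)
    (hatlas : IsNashAtlas (translatedAtlas ψ)) (α : GL (Fin n) 𝕂) (s t : Fin n → 𝕂) :
    GenericallyAlgebraicOver 𝕂 (g ∘ shift t ∘ glHomeomorph α) (f ∘ shift s) ↔
      GenericallyAlgebraicOver 𝕂 (g ∘ glHomeomorph α) f := by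
  have hA (r : Fin n → 𝕂) (p : Fin n → ℂ) :
      AnalyticAt ℂ ((glHomeomorph α).trans (shift r)) p :=
    (analyticAt_shift _ _).comp (analyticAt_glHomeomorph α p)
  have hgA (r : Fin n → 𝕂) := hg.comp_homeomorph ((glHomeomorph α).trans (shift r)) (hA r)
  have hgAi (r : Fin n → 𝕂) := hgi.comp_homeomorph ((glHomeomorph α).trans (shift r))
  have hchange (r r' : Fin n → 𝕂) : GenericallyAlgebraicOver 𝕂
      (g ∘ (glHomeomorph α).trans (shift r)) (g ∘ (glHomeomorph α).trans (shift r')) :=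
    (genericallyAlgebraicOver_shift_shift hg hgi hψ hatlas r r').comp_homeomorph (glHomeomorph α)
  have h0 : g ∘ glHomeomorph α = g ∘ (glHomeomorph α).trans (shift (0 : Fin n → 𝕂)) := by
    change _ = g ∘ shift (0 : Fin n → 𝕂) ∘ glHomeomorph α
    rw [shift_zero, Function.id_comp]
  have hcomp (r : Fin n → 𝕂) : ((g ∘ glHomeomorph α) ∘ shift r) =
      g ∘ (glHomeomorph α).trans (shift (glLinear α r)) := by
    rw [Function.comp_assoc, glHomeomorph_comp_shift]; rfl
  have hs := hf.comp_homeomorph (shift s) (analyticAt_shift s)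
  have hsi := hfi.comp_homeomorph (shift s)
  constructor
  · intro H
    have H1 : GenericallyAlgebraicOver 𝕂 ((g ∘ glHomeomorph α) ∘ shift s) (f ∘ shift s) := by
      rw [hcomp]
      exact GenericallyAlgebraicOver.trans hs hsi (hgA t) (hgAi t) (hgA _) (hchange _ _) H
    have := H1.comp_homeomorph (shift (-s))
    simpa only [Function.comp_assoc, shift_comp_shift, neg_add_cancel, shift_zero,
      Function.comp_id] using this
  · intro H
    have H1 := H.comp_homeomorph (shift s)
    rw [hcomp] at H1
    exact GenericallyAlgebraicOver.trans hs hsi (hgA _) (hgAi _) (hgA _) (hchange t _) H1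

end Charts

/-! ### Semialgebraic neighbourhoods -/

theorem isSemialgebraicReal_univ {ι : Type*} : IsSemialgebraicReal (univ : Set (ι → ℝ)) := by
  simpa using IsSemialgebraicReal.pos (ι := ι) 1

theorem IsSemialgebraicReal.inter {ι : Type*} {S T : Set (ι → ℝ)} (hS : IsSemialgebraicReal S)
    (hT : IsSemialgebraicReal T) : IsSemialgebraicReal (S ∩ T) := by
  rw [← compl_compl (S ∩ T), compl_inter]
  exact (hS.compl.union hT.compl).compl

theorem IsSemialgebraicReal.biInter {ι κ : Type*} (s : Finset κ) {S : κ → Set (ι → ℝ)}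
    (hS : ∀ k, IsSemialgebraicReal (S k)) : IsSemialgebraicReal (⋂ k ∈ s, S k) := by
  classical
  induction s using Finset.induction_on with
  | empty => simpa using isSemialgebraicReal_univ
  | insert k s _ ih =>
    rw [Finset.set_biInter_insert]
    exact (hS k).inter ih

/-- Balls for the sup norm of `𝕂 ^ ι` are semialgebraic. -/
theorem isSemialgebraic_ball {𝕂 ι : Type*} [RCLike 𝕂] [Fintype ι] (p : ι → 𝕂) {ε : ℝ}
    (hε : 0 < ε) : IsSemialgebraic (Metric.ball p ε) := by
  refine ⟨⋂ i ∈ Finset.univ, {y | 0 < MvPolynomial.eval y (MvPolynomial.C (ε ^ 2) -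
      (MvPolynomial.X (Sum.inl i) - MvPolynomial.C (RCLike.re (p i))) ^ 2 -
      (MvPolynomial.X (Sum.inr i) - MvPolynomial.C (RCLike.im (p i))) ^ 2)},
    IsSemialgebraicReal.biInter _ fun i => .pos _, ?_⟩
  ext x
  simp only [mem_ball_iff_norm, pi_norm_lt_iff hε, Finset.mem_univ, iInter_true, mem_preimage,
    mem_iInter, mem_ofPred_eq, map_sub, map_pow, MvPolynomial.eval_C, MvPolynomial.eval_X,
    realCoords, Sum.elim_inl, Sum.elim_inr, Pi.sub_apply]
  refine forall_congr' fun i => ?_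
  rw [← sq_lt_sq₀ (norm_nonneg _) hε.le, RCLike.norm_sq_eq_def, map_sub, map_sub]
  constructor <;> intro h <;> linarith

/-! ### Locally Nash maps and algebraic dependence -/

section Nash

variable {𝕂 : Type*} [RCLike 𝕂] {n : ℕ} {f g : (Fin n → ℂ) → Fin n → ℂ}
  {φ ψ : OpenPartialHomeomorph (Fin n → 𝕂) (Fin n → 𝕂)}

theorem toComplex_injective : Function.Injective (toComplex 𝕂) := (toComplex 𝕂).injective

/-- If `g ∘ α` is algebraic over `𝕂(f)`, then `α` is a locally Nash map. -/
theorem isLocallyNashMap_glLinear (hf : IsMeromorphicMap f) (hfi : GenericallyIndependent 𝕂 f)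
    (hg : IsMeromorphicMap g) (hgi : GenericallyIndependent 𝕂 g)
    (hφ : IsShiftChart f φ) (hψ : IsShiftChart g ψ) (hatlas : IsNashAtlas (translatedAtlas ψ))
    (α : GL (Fin n) 𝕂) (H : GenericallyAlgebraicOver 𝕂 (g ∘ glHomeomorph α) f) :
    IsLocallyNashMap (translatedAtlas φ) (translatedAtlas ψ) (glLinear α) := by
  obtain ⟨a, ha⟩ := hφ.eq_shift
  obtain ⟨b, hb⟩ := hψ.eq_shift
  refine ⟨(glLinear α).continuous, ?_⟩
  rintro c _ ⟨d, rfl⟩ hd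
  change glLinear α c ∈ (translatedChart ψ d).source at hd
  set e := translatedChart φ c
  set e' := translatedChart ψ d
  have hce : c ∈ e.source := by
    rw [mem_translatedChart_source, neg_add_cancel]
    exact hφ.zero_mem
  have hV : IsOpen (e.symm.source ∩ e.symm ⁻¹' (glLinear α ⁻¹' e'.source)) :=
    e.symm.isOpen_inter_preimage (e'.open_source.preimage (glLinear α).continuous)
  obtain ⟨ε, hε, hball⟩ := Metric.isOpen_iff.1 hV (e c)
    ⟨e.map_source hce, by simpa [e.left_inv hce] using hd⟩
  set B := Metric.ball (e c) ε
  have hB (x : Fin n → 𝕂) (hx : x ∈ B) : x ∈ e.target ∧ glLinear α (e.symm x) ∈ e'.source :=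
    hball hx
  have himage : e '' (e.source ∩ e ⁻¹' B) = B := by
    rw [image_inter_preimage, e.image_source_eq_target, inter_eq_right]
    exact fun x hx => (hB x hx).1
  refine ⟨e, translatedChart_mem c, e.source ∩ e ⁻¹' B,
    e.isOpen_inter_preimage Metric.isOpen_ball, ⟨hce, Metric.mem_ball_self hε⟩,
    inter_subset_left, fun u hu => ?_, ?_⟩
  · have := (hB _ hu.2).2
    rwa [e.left_inv hu.1] at this
  rw [himage]
  refine ⟨Metric.isOpen_ball, isSemialgebraic_ball _ hε, fun x hx => ?_, fun i => ?_⟩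
  · have h1 : AnalyticAt 𝕂 (fun y => -d + glLinear α (c + φ.symm y)) x :=
      analyticAt_const.add (((glLinear α).analyticAt _).fun_comp
        (analyticAt_const.add (hφ.analytic_symm x (hB x hx).1)))
    have h2 : AnalyticAt 𝕂 ψ (-d + glLinear α (c + φ.symm x)) := by
      refine hψ.analytic _ ?_
      have := (hB x hx).2
      rwa [translatedChart_symm_apply] at this
    refine (AnalyticAt.fun_comp (g := ψ) (f := fun y => -d + glLinear α (c + φ.symm y))
      h2 h1).congr (Eventually.of_forall fun y => ?_)
    simp only [Function.comp_apply, e, translatedChart_symm_apply]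
    rfl
  · obtain ⟨P, hP, hz⟩ := ((genericallyAlgebraicOver_shift_iff hf hfi hg hgi hψ hatlas α
      (a - c) (b - d)).2 H).meromorphicAlgebraicOver i
    refine ⟨P, hP, fun x hx => toComplex_injective ?_⟩
    obtain ⟨hxe, hxe'⟩ := hB x hx
    set u := e.symm x with hu
    have hus : -c + u ∈ φ.source := e.map_target hxe
    have hus' : -d + glLinear α u ∈ ψ.source := hxe'
    have hux : φ (-c + u) = x := e.right_inv hxe
    have e1 : shift (a - c) (toComplexVec u) = toComplexVec (-c + u + a) := by
      rw [shift_toComplexVec]; congr 1; abel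
    have e2 : shift (b - d) (glHomeomorph α (toComplexVec u)) =
        toComplexVec (-d + glLinear α u + b) := by
      rw [glHomeomorph_toComplexVec, shift_toComplexVec]; congr 1; abel
    have := hz (toComplexVec u) ⟨by
        refine mem_holoDomain_comp (A := shift (b - d) ∘ glHomeomorph α)
          ((analyticAt_shift _ _).comp (analyticAt_glHomeomorph α _)) ?_
        rw [Function.comp_apply, e2]
        exact (hb _ hus').1, by
        refine mem_holoDomain_comp (analyticAt_shift _ _) ?_
        rw [e1]
        exact (ha _ hus).1⟩
    simp only [Function.comp_apply, e1, e2] at this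
    rw [← (ha _ hus).2, ← (hb _ hus').2, hux] at this
    rw [map_zero]
    exact (map_eval₂_toComplex P x _).trans this

/-- A locally Nash additive map is `𝕂`-linear: being continuous it is `ℝ`-linear, hence equal to
its own derivative at `0`, and it is `𝕂`-differentiable at `0` as it is `𝕂`-analytic in charts. -/
theorem IsLocallyNashMap.map_smul (hφ : IsShiftChart f φ) (hψ : IsShiftChart g ψ)
    {α : (Fin n → 𝕂) ≃+ (Fin n → 𝕂)}
    (hα : IsLocallyNashMap (translatedAtlas φ) (translatedAtlas ψ) α) (k : 𝕂) (x : Fin n → 𝕂) :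
    α (k • x) = k • α x := by
  obtain ⟨_, ⟨c, rfl⟩, U, hU, h0U, hUs, hmaps, hN⟩ := hα.nash 0 _ (translatedChart_mem 0) (by
    rw [mem_translatedChart_source]
    simpa using hψ.zero_mem)
  change U ⊆ (translatedChart φ c).source at hUs
  change IsNashOn (translatedChart ψ 0 ∘ α ∘ (translatedChart φ c).symm)
    (translatedChart φ c '' U) at hN
  have h1 : AnalyticAt 𝕂 (translatedChart φ c) 0 :=
    (hφ.analytic _ (hUs h0U)).fun_comp (analyticAt_const.add analyticAt_id)
  have h2 := hN.analytic _ (mem_image_of_mem _ h0U)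
  have h3 : AnalyticAt 𝕂 (translatedChart ψ 0).symm (translatedChart ψ 0 (α 0)) := by
    have : AnalyticAt 𝕂 (fun y => 0 + ψ.symm y) (translatedChart ψ 0 (α 0)) :=
      analyticAt_const.add (hψ.analytic_symm _
        ((translatedChart ψ 0).map_source (hmaps h0U)))
    exact this.congr (Eventually.of_forall fun y => (translatedChart_symm_apply 0 y).symm)
  have h4 := h2.comp h1
  have h5 : AnalyticAt 𝕂 α 0 := by
    refine AnalyticAt.congr (AnalyticAt.comp (g := (translatedChart ψ 0).symm) ?_ h4) ?_
    · simpa [(translatedChart φ c).left_inv (hUs h0U)] using h3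
    · filter_upwards [hU.mem_nhds h0U] with u hu
      simp only [Function.comp_apply]
      rw [(translatedChart φ c).left_inv (hUs hu), (translatedChart ψ 0).left_inv (hmaps hu)]
  let αℝ : (Fin n → 𝕂) →L[ℝ] (Fin n → 𝕂) := (α : (Fin n → 𝕂) →+ _).toRealLinearMap hα.continuous
  have h6 : (fderiv 𝕂 α 0).restrictScalars ℝ = αℝ :=
    (h5.differentiableAt.hasFDerivAt.restrictScalars ℝ).unique αℝ.hasFDerivAt
  have h7 (y : Fin n → 𝕂) : α y = fderiv 𝕂 α 0 y := (DFunLike.congr_fun h6 y).symm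
  rw [h7, h7, _root_.map_smul]

/-- If `α ∈ GL_n(𝕂)` is locally Nash, then `g ∘ α` is algebraic over `𝕂(f)`: the relations that
express this in charts near `0` extend to `ℂ ^ n`, and the translates that enter them can be
removed. -/
theorem genericallyAlgebraicOver_of_isLocallyNashMap (hf : IsMeromorphicMap f)
    (hfi : GenericallyIndependent 𝕂 f) (hg : IsMeromorphicMap g)
    (hgi : GenericallyIndependent 𝕂 g) (hφ : IsShiftChart f φ) (hψ : IsShiftChart g ψ)
    (hatlas : IsNashAtlas (translatedAtlas ψ)) (α : GL (Fin n) 𝕂)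
    (hα : IsLocallyNashMap (translatedAtlas φ) (translatedAtlas ψ) (glLinear α)) :
    GenericallyAlgebraicOver 𝕂 (g ∘ glHomeomorph α) f := by
  obtain ⟨a, ha⟩ := hφ.eq_shift
  obtain ⟨b, hb⟩ := hψ.eq_shift
  obtain ⟨_, ⟨c, rfl⟩, U, hU, h0U, hUs, hmaps, hN⟩ := hα.nash 0 _ (translatedChart_mem 0) (by
    rw [mem_translatedChart_source]
    simpa using hψ.zero_mem)
  refine (genericallyAlgebraicOver_shift_iff hf hfi hg hgi hψ hatlas α (a - c) (b - 0)).1 ?_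
  refine genericallyAlgebraicOver_of_charts hf hg ha hb (glHomeomorph α)
    (analyticAt_glHomeomorph α) (glHomeomorph_toComplexVec α) hU ⟨0, h0U⟩
    (fun u hu => hUs hu) (fun u hu => hmaps hu) fun i => ?_
  obtain ⟨P, hP, hz⟩ := hN.algebraic i
  refine ⟨P, hP, fun u hu => ?_⟩
  have := hz _ (mem_image_of_mem _ hu)
  simp only [Function.comp_apply] at this
  rwa [((Homeomorph.addLeft (-c)).transOpenPartialHomeomorph φ).left_inv (hUs hu)] at this

/-- The matrix of a linear automorphism of `𝕂 ^ n`. -/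
def glOfLinearEquiv (e : (Fin n → 𝕂) ≃ₗ[𝕂] (Fin n → 𝕂)) : GL (Fin n) 𝕂 where
  val := LinearMap.toMatrix' e
  inv := LinearMap.toMatrix' e.symm
  val_inv := by
    rw [← LinearMap.toMatrix'_comp, LinearEquiv.comp_coe, LinearEquiv.symm_trans_self]
    simp
  inv_val := by
    rw [← LinearMap.toMatrix'_comp, LinearEquiv.comp_coe, LinearEquiv.self_trans_symm]
    simp

theorem glLinear_glOfLinearEquiv (e : (Fin n → 𝕂) ≃ₗ[𝕂] (Fin n → 𝕂)) (u : Fin n → 𝕂) :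
    glLinear (glOfLinearEquiv e) u = e u :=
  LinearMap.toMatrix'_mulVec (e : (Fin n → 𝕂) →ₗ[𝕂] (Fin n → 𝕂)) u

/-- The additive automorphism of `𝕂 ^ n` given by an invertible matrix. -/
def glAddEquiv (α : GL (Fin n) 𝕂) : (Fin n → 𝕂) ≃+ (Fin n → 𝕂) where
  toFun := glLinear α
  invFun := glLinear α⁻¹
  left_inv u := by
    change (α⁻¹ : GL (Fin n) 𝕂).val.mulVec (α.val.mulVec u) = u
    rw [Matrix.mulVec_mulVec, ← Units.val_mul]
    simp
  right_inv u := by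
    change α.val.mulVec ((α⁻¹ : GL (Fin n) 𝕂).val.mulVec u) = u
    rw [Matrix.mulVec_mulVec, ← Units.val_mul]
    simp
  map_add' := map_add (glLinear α)

end Nash

end

theorem mainTheorem7 {𝕂 : Type*} [RCLike 𝕂] {n : ℕ}
    (f g : (Fin n → ℂ) → (Fin n → ℂ))
    (hf : IsNashDatum 𝕂 f) (hg : IsNashDatum 𝕂 g)
    (𝒢 ℋ : LocallyNashGroup 𝕂 (Fin n) (Fin n → 𝕂))
    (h𝒢 : 𝒢.IsGivenBy f) (hℋ : ℋ.IsGivenBy g) :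
    𝒢.Isomorphic ℋ ↔
      ∃ α : GL (Fin n) 𝕂, MeromorphicAlgebraicOver 𝕂 (g ∘ glAct α) f := by
  obtain ⟨φ, hφ, h𝒢φ⟩ := h𝒢
  obtain ⟨ψ, hψ, hℋψ⟩ := hℋ
  have hφA : IsNashAtlas (translatedAtlas φ) := h𝒢φ ▸ 𝒢.isNashAtlas
  have hψA : IsNashAtlas (translatedAtlas ψ) := hℋψ ▸ ℋ.isNashAtlas
  have hfm := hf.meromorphic.meromorphic
  have hgm := hg.meromorphic.meromorphic
  have hfi := hf.aat.genericallyIndependent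
  have hgi := hg.aat.genericallyIndependent
  rw [LocallyNashGroup.Isomorphic, h𝒢φ, hℋψ]
  constructor
  · rintro ⟨α, hα, -⟩
    let e : (Fin n → 𝕂) ≃ₗ[𝕂] (Fin n → 𝕂) := { α with map_smul' := hα.map_smul hφ hψ }
    have he : ⇑(glLinear (glOfLinearEquiv e)) = α := funext (glLinear_glOfLinearEquiv e)
    exact ⟨glOfLinearEquiv e, (genericallyAlgebraicOver_of_isLocallyNashMap hfm hfi hgm hgi hφ hψ
      hψA _ (he ▸ hα)).meromorphicAlgebraicOver⟩
  · rintro ⟨α, H⟩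
    have hgα := hgm.comp_homeomorph _ (analyticAt_glHomeomorph α)
    have hgαi := hgi.comp_homeomorph (glHomeomorph α)
    have H1 : GenericallyAlgebraicOver 𝕂 (g ∘ glHomeomorph α) f :=
      MeromorphicAlgebraicOver.genericallyAlgebraicOver hfm hgα H
    have H2 : GenericallyAlgebraicOver 𝕂 (f ∘ glHomeomorph α⁻¹) g := by
      have := (H1.exchange hfm hfi hgα hgαi).comp_homeomorph (glHomeomorph α).symm
      rwa [Function.comp_assoc, Homeomorph.self_comp_symm] at this
    exact ⟨glAddEquiv α,
      isLocallyNashMap_glLinear hfm hfi hgm hgi hφ hψ hψA α H1,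
      isLocallyNashMap_glLinear hgm hgi hfm hfi hψ hφ hφA α⁻¹ H2⟩
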